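/- Let $\beta>0$ be fixed. On $d\ge 1$ qubits let $H=\sum_{i=1}^d X_i$ (the adjacency matrix of the $d$-dimensional hypercube graph), and take the $d$ jump operators $A^a=\frac{1}{\sqrt d}Z_a$, $a=1,\dots,d$, where $X_i,Z_a$ are Pauli operators acting on one qubit. For $\sigma_E>0$ put $$f(t)=e^{-\sigma_E^2t^2}\sqrt{\sigma_E\sqrt{2/\pi}},\qquad \hat f(\omega)=\frac{1}{\sqrt{\sigma_E\sqrt{2\pi}}}\,e^{-\omega^2/(4\sigma_E^2)},\qquad \gamma(\omega)=\exp\!\Big(-\beta\max\big(\omega+\tfrac{\beta\sigma_E^2}{2},0\big)\Big),$$ $$\hat A^a(\omega)=\frac{1}{\sqrt{2\pi}}\int_{-\infty}^{\infty}e^{iHt}A^ae^{-iHt}e^{-i\omega t}f(t)\,dt,\qquad \theta(\nu_1,\nu_2)=\int_{-\infty}^\infty \hat f(\omega-\nu_1)\hat f(\omega-\nu_2)\gamma(\omega)\,d\omega .$$ For a Bohr frequency (difference of two eigenvalues of $H$) $\nu$ let $A^a_\nu=\sum_{E-E'=\nu}P_EA^aP_{E'}$, where $P_E$ is the spectral projection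 of $H$ for the eigenvalue $E$. Let $$B=\sum_a\sum_{\nu_1,\nu_2}\frac{\tanh(-\beta(\nu_1-\nu_2)/4)}{2i}\,\theta(\nu_1,\nu_2)\,(A^a_{\nu_2})^\dagger A^a_{\nu_1},$$ the sum over all Bohr frequencies $\nu_1,\nu_2$ of $H$. The CKG Lindbladian is the superoperator $$\mathcal L_\beta[X]=-i[B,X]+\sum_{a}\int_{-\infty}^{\infty}\gamma(\omega)\Big(\hat A^a(\omega)X\hat A^a(\omega)^\dagger-\tfrac12\{\hat A^a(\omega)^\dagger\hat A^a(\omega),X\}\Big)\,d\omega .$$ Its spectral gap is $\lambda_{\mathrm{gap}}(\mathcal L_\beta)=\min_{j>1}|\lambda_j|$, where $\lambda_1=0,\lambda_2,\dots,\lambda_{4^d}$ are the eigenvalues of $\mathcal L_\beta$ with algebraic multiplicity. Then there is an energy resolution $\sigma_E>0$, depending only on $\beta$, for which $\lambda_{\mathrm{gap}}(\mathcal L_\beta)=\Omega(1/d)$; precisely, there are $\sigma_E>0$ and $c>0$, depending only on $\beta$, such that $\lambda_{\mathrm{gap}}(\mathcal L_\beta)\ge c/d$ for every $d\ge 1$.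 -/

import Mathlib

open scoped Matrix

noncomputable section

namespace CKG

/-! ## The CKG Lindbladian of a finite-dimensional system -/

section General

variable {n : Type*} [Fintype n] [DecidableEq n]

/-- The Gaussian time filter `f(t) = exp(-σ² t²) √(σ √(2/π))`, normalized in `L²`. -/
def timeFilter (σ t : ℝ) : ℝ :=
  Real.exp (-σ ^ 2 * t ^ 2) * Real.sqrt (σ * Real.sqrt (2 / Real.pi))

/-- The Fourier transform `f̂(ω) = exp(-ω² / (4σ²)) / √(σ √(2π))` of the time filter. -/
def freqFilter (σ ω : ℝ) : ℝ :=
  1 / Real.sqrt (σ * Real.sqrt (2 * Real.pi)) * Real.exp (-ω ^ 2 / (4 * σ ^ 2))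

/-- The shifted Metropolis weight `γ(ω) = exp(-β max(ω + β σ² / 2, 0))`. -/
def metropolis (β σ ω : ℝ) : ℝ :=
  Real.exp (-β * max (ω + β * σ ^ 2 / 2) 0)

/-- `θ(ν₁, ν₂) = ∫ f̂(ω - ν₁) f̂(ω - ν₂) γ(ω) dω`. -/
def theta (β σ ν₁ ν₂ : ℝ) : ℝ :=
  ∫ ω : ℝ, freqFilter σ (ω - ν₁) * freqFilter σ (ω - ν₂) * metropolis β σ ω

/-- Heisenberg evolution `e^{iHt} A e^{-iHt}`. -/
def heisenberg (H A : Matrix n n ℂ) (t : ℝ) : Matrix n n ℂ :=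
  NormedSpace.exp ((Complex.I * (t : ℂ)) • H) * A *
    NormedSpace.exp ((-(Complex.I * (t : ℂ))) • H)

/-- The operator Fourier transform
`Â(ω) = (2π)^{-1/2} ∫ e^{iHt} A e^{-iHt} e^{-iωt} f(t) dt`, the integral taken entrywise. -/
def oft (σ : ℝ) (H A : Matrix n n ℂ) (ω : ℝ) : Matrix n n ℂ :=
  Matrix.of fun i j =>
    ((1 / Real.sqrt (2 * Real.pi) : ℝ) : ℂ) *
      ∫ t : ℝ, heisenberg H A t i j * Complex.exp (-(Complex.I * (ω : ℂ) * (t : ℂ))) *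
        (timeFilter σ t : ℂ)

/-- The dissipator `X ↦ K X K† - ½ {K† K, X}` of a Lindblad operator `K`. -/
def dissipator (K : Matrix n n ℂ) : Matrix n n ℂ →ₗ[ℂ] Matrix n n ℂ where
  toFun X := K * X * Kᴴ - (1 / 2 : ℂ) • (Kᴴ * K * X + X * (Kᴴ * K))
  map_add' X Y := by
    simp only [mul_add, add_mul, smul_add]; abel
  map_smul' c X := by
    simp only [mul_smul_comm, smul_mul_assoc, smul_add, smul_sub, RingHom.id_apply,
      smul_comm c (1 / 2 : ℂ)]

/-- The superoperator `X ↦ -i [B, X]`. -/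
def commutatorPart (B : Matrix n n ℂ) : Matrix n n ℂ →ₗ[ℂ] Matrix n n ℂ where
  toFun X := (-Complex.I) • (B * X - X * B)
  map_add' X Y := by
    rw [← smul_add]; congr 1; noncomm_ring
  map_smul' c X := by
    simp only [mul_smul_comm, smul_mul_assoc, ← smul_sub, RingHom.id_apply,
      smul_comm c (-Complex.I)]

/-- The integral `∫ D(ω) dω` of a superoperator-valued function, taken entrywise in the basis of
matrix units. -/
def integralSuperop (D : ℝ → Matrix n n ℂ →ₗ[ℂ] Matrix n n ℂ) :
    Matrix n n ℂ →ₗ[ℂ] Matrix n n ℂ :=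
  Matrix.toLin (Matrix.stdBasis ℂ n n) (Matrix.stdBasis ℂ n n)
    (Matrix.of fun p q => ∫ ω : ℝ,
      LinearMap.toMatrix (Matrix.stdBasis ℂ n n) (Matrix.stdBasis ℂ n n) (D ω) p q)

/-- The finite set of Bohr frequencies `E_l - E_m` of a Hermitian `H`. -/
def bohrFrequencies {H : Matrix n n ℂ} (hH : H.IsHermitian) : Finset ℝ :=
  Finset.univ.image fun p : n × n => hH.eigenvalues p.1 - hH.eigenvalues p.2

/-- The part `A_ν = ∑_{E_l - E_m = ν} |l⟩⟨l| A |m⟩⟨m|` of `A` with Bohr frequency `ν`, where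
`|l⟩` runs over an orthonormal eigenbasis of `H` (the sum does not depend on its choice). -/
def bohrComponent {H : Matrix n n ℂ} (hH : H.IsHermitian) (A : Matrix n n ℂ) (ν : ℝ) :
    Matrix n n ℂ :=
  (hH.eigenvectorUnitary : Matrix n n ℂ) *
    (Matrix.of fun l m =>
      if hH.eigenvalues l - hH.eigenvalues m = ν then
        ((hH.eigenvectorUnitary : Matrix n n ℂ)ᴴ * A * (hH.eigenvectorUnitary : Matrix n n ℂ)) l m
      else 0) *
    (hH.eigenvectorUnitary : Matrix n n ℂ)ᴴ

/-- The coherent term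
`B = ∑_a ∑_{ν₁, ν₂} tanh(-β (ν₁ - ν₂) / 4) / (2i) · θ(ν₁, ν₂) (A^a_{ν₂})† A^a_{ν₁}`. -/
def coherentTerm {ι : Type*} [Fintype ι] (β σ : ℝ) {H : Matrix n n ℂ} (hH : H.IsHermitian)
    (A : ι → Matrix n n ℂ) : Matrix n n ℂ :=
  ∑ a, ∑ ν₁ ∈ bohrFrequencies hH, ∑ ν₂ ∈ bohrFrequencies hH,
    (((Real.tanh (-β * (ν₁ - ν₂) / 4) : ℝ) : ℂ) / (2 * Complex.I) * (theta β σ ν₁ ν₂ : ℂ)) •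
      ((bohrComponent hH (A a) ν₂)ᴴ * bohrComponent hH (A a) ν₁)

/-- The CKG Lindbladian at inverse temperature `β` and energy resolution `σ`, with Hamiltonian
`H` and jump operators `A a`:
`ℒ[X] = -i[B, X] + ∑_a ∫ γ(ω) (Â^a(ω) X Â^a(ω)† - ½ {Â^a(ω)† Â^a(ω), X}) dω`. -/
def lindbladian {ι : Type*} [Fintype ι] (β σ : ℝ) {H : Matrix n n ℂ} (hH : H.IsHermitian)
    (A : ι → Matrix n n ℂ) : Matrix n n ℂ →ₗ[ℂ] Matrix n n ℂ :=
  commutatorPart (coherentTerm β σ hH A) +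
    ∑ a, integralSuperop fun ω =>
      (metropolis β σ ω : ℂ) • dissipator (oft σ H (A a) ω)

open Classical in
/-- The spectral gap `min_{j > 1} |λ_j|`, where `λ_1 = 0, λ_2, …` are the eigenvalues of the
generator `L` counted with algebraic multiplicity: one copy of the eigenvalue `0` is removed, so
the gap is `0` when `0` is a degenerate eigenvalue. -/
def spectralGap (L : Matrix n n ℂ →ₗ[ℂ] Matrix n n ℂ) : ℝ :=
  sInf {r : ℝ | ∃ z ∈ L.charpoly.roots.erase 0, r = ‖z‖}

end General

/-! ## The hypercube as a system of `d` qubits -/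

/-- Pauli `X`. -/
def pauliX : Matrix (Fin 2) (Fin 2) ℂ := !![0, 1; 1, 0]

/-- Pauli `Z`. -/
def pauliZ : Matrix (Fin 2) (Fin 2) ℂ := !![1, 0; 0, -1]

/-- The operator on `d` qubits that acts as `M` on qubit `a` and as the identity on the others,
in the computational basis of bitstrings. -/
def siteOp {d : ℕ} (M : Matrix (Fin 2) (Fin 2) ℂ) (a : Fin d) :
    Matrix (Fin d → Fin 2) (Fin d → Fin 2) ℂ :=
  Matrix.of fun x y => if ∀ b, b ≠ a → x b = y b then M (x a) (y a) else 0

/-- The hypercube Hamiltonian `H = ∑_i X_i`. -/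
def hypercubeHamiltonian (d : ℕ) : Matrix (Fin d → Fin 2) (Fin d → Fin 2) ℂ :=
  ∑ i : Fin d, siteOp pauliX i

/-- The jump operators `A^a = d^{-1/2} Z_a`. -/
def hypercubeJump (d : ℕ) (a : Fin d) : Matrix (Fin d → Fin 2) (Fin d → Fin 2) ℂ :=
  ((1 / Real.sqrt d : ℝ) : ℂ) • siteOp pauliZ a

theorem hypercubeHamiltonian_isHermitian (d : ℕ) : (hypercubeHamiltonian d).IsHermitian := by
  unfold hypercubeHamiltonian Matrix.IsHermitian
  rw [Matrix.conjTranspose_sum]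
  refine Finset.sum_congr rfl fun a _ => ?_
  ext x y
  simp only [siteOp, Matrix.conjTranspose_apply, Matrix.of_apply]
  have hc : (∀ b, b ≠ a → y b = x b) ↔ (∀ b, b ≠ a → x b = y b) :=
    ⟨fun h b hb => (h b hb).symm, fun h b hb => (h b hb).symm⟩
  simp only [hc]
  split_ifs with h
  · generalize x a = u
    generalize y a = v
    fin_cases u <;> fin_cases v <;> simp [pauliX]
  · simp

/-- The `d`-dimensional hypercube graph: bitstrings joined when their Hamming distance is `1`. -/
def hypercubeGraph (d : ℕ) : SimpleGraph (Fin d → Fin 2) where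
  Adj x y := hammingDist x y = 1
  symm := ⟨fun x y h => by rw [hammingDist_comm]; exact h⟩
  loopless := ⟨fun x h => by simp at h⟩

open Classical in
/-- Consistency check: `∑_i X_i` is the adjacency matrix of the hypercube graph. -/
theorem hypercubeHamiltonian_eq_adjMatrix (d : ℕ) :
    hypercubeHamiltonian d = (hypercubeGraph d).adjMatrix ℂ := by
  ext x y
  rw [SimpleGraph.adjMatrix_apply]
  have hadj : (hypercubeGraph d).Adj x y ↔ hammingDist x y = 1 := Iff.rfl
  simp only [hypercubeHamiltonian, Matrix.sum_apply, siteOp, Matrix.of_apply]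
  have key : ∀ a : Fin d,
      (if ∀ b, b ≠ a → x b = y b then pauliX (x a) (y a) else 0) =
        if ({i | x i ≠ y i} : Finset (Fin d)) = {a} then (1 : ℂ) else 0 := by
    intro a
    have hX : ∀ u v : Fin 2, pauliX u v = if u ≠ v then 1 else 0 := by
      intro u v
      fin_cases u <;> fin_cases v <;> simp [pauliX]
    rw [hX, ← ite_and]
    congr 1
    simp only [Finset.ext_iff, Finset.mem_filter, Finset.mem_univ, true_and,
      Finset.mem_singleton, eq_iff_iff]
    constructor
    · rintro ⟨h1, h2⟩ b
      constructor
      · intro hb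
        by_contra hne
        exact hb (h1 b hne)
      · rintro rfl
        exact h2
    · intro h
      refine ⟨fun b hb => ?_, (h a).2 rfl⟩
      by_contra hne
      exact hb ((h b).1 hne)
  simp only [key, hadj]
  split_ifs with h
  · obtain ⟨a, ha⟩ := Finset.card_eq_one.1 h
    rw [ha]
    simp [Finset.singleton_inj]
  · refine Finset.sum_eq_zero fun a _ => ?_
    rw [if_neg]
    intro ha
    exact h (Finset.card_eq_one.2 ⟨a, ha⟩)

end CKG

end

/-!
Each jump splits as `Z_a = |+⟩⟨-|_a + |-⟩⟨+|_a`, and `[H, ·]` multiplies the two parts by `2` and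
`-2`. They are therefore the Bohr components of `Z_a`, and the operator Fourier transform merely
scales them by `f̂(ω ∓ 2)`. Since `(|+⟩⟨-|)† |-⟩⟨+| = 0`, and `tanh` vanishes on the diagonal, the
coherent term `B` is zero. Integrating over `ω` leaves a sum of commuting one-qubit generators
`d⁻¹ 𝒢_a`, in which `|+⟩⟨-|` has rate `p = θ(2, 2)`, `|-⟩⟨+|` has rate `q = θ(-2, -2)`, and the
cross terms have weight `k = θ(2, -2)`.

The generator `𝒢` of one qubit has the eigenvalues `0`, `-(p + q)` and `-(p + q) / 2 ± k`. Products
of its eigenoperators form an eigenbasis of the Lindbladian whose eigenvalues are sums of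
one-qubit eigenvalues, so the gap is at least `((p + q) / 2 - k) / d`. Here `2 k < p + q` because
`p - 2 k + q = ∫ (f̂(ω - 2) - f̂(ω + 2))² γ(ω) dω`.
-/

noncomputable section

namespace CKG

section SpectralGap

theorem roots_charpoly_of_eigenbasis {R V κ : Type*} [CommRing R] [IsDomain R] [AddCommGroup V]
    [Module R V] [Module.Finite R V] [Module.Free R V] [Fintype κ] (b : Module.Basis κ R V)
    {L : V →ₗ[R] V} {μ : κ → R} (h : ∀ j, L (b j) = μ j • b j) :
    L.charpoly.roots = Finset.univ.val.map μ := by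
  classical
  have hdiag : LinearMap.toMatrix b b L = Matrix.diagonal μ := by
    ext i j
    rw [LinearMap.toMatrix_apply, h, map_smul, Module.Basis.repr_self, Finsupp.smul_single_one,
      Matrix.diagonal_apply, Finsupp.single_apply]
    grind
  rw [← LinearMap.charpoly_toMatrix L b, hdiag, Matrix.charpoly_diagonal]
  simpa using Polynomial.roots_multiset_prod_X_sub_C (Finset.univ.val.map μ)

theorem le_spectralGap_of_eigenbasis {n κ : Type*} [Fintype n] [Finite κ] [Nontrivial κ]
    (b : Module.Basis κ ℂ (Matrix n n ℂ)) {L : Matrix n n ℂ →ₗ[ℂ] Matrix n n ℂ} {μ : κ → ℂ}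
    (h : ∀ j, L (b j) = μ j • b j) {j₀ : κ} (h₀ : μ j₀ = 0) {g : ℝ}
    (hg : ∀ j, j ≠ j₀ → g ≤ ‖μ j‖) : g ≤ spectralGap L := by
  classical
  let : Fintype κ := Fintype.ofFinite κ
  have hroots : L.charpoly.roots.erase 0 = (Finset.univ.erase j₀).val.map μ := by
    rw [roots_charpoly_of_eigenbasis b h, Finset.erase_val,
      ← Multiset.cons_erase (Finset.mem_univ_val j₀), Multiset.map_cons, h₀,
      Multiset.erase_cons_head, Multiset.erase_cons_head]
  have hmem (z : ℂ) : z ∈ L.charpoly.roots.erase 0 ↔ ∃ j ≠ j₀, μ j = z := by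
    simp only [hroots, Multiset.mem_map, Finset.mem_val, Finset.mem_erase, Finset.mem_univ,
      and_true]
  obtain ⟨j₁, hj₁⟩ := exists_ne j₀
  refine le_csInf ⟨‖μ j₁‖, μ j₁, ?_, rfl⟩ ?_
  · convert (hmem (μ j₁)).2 ⟨j₁, hj₁, rfl⟩
  · rintro r ⟨z, hz, rfl⟩
    obtain ⟨j, hj, rfl⟩ := (hmem z).1 (by convert hz)
    exact hg j hj

end SpectralGap

section PiKronecker

theorem mulSingle_mul_eq_update {ι M : Type*} [DecidableEq ι] [MulOneClass M] (a : ι) (s : M)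
    (u : ι → M) :
    Pi.mulSingle a s * u = Function.update u a (s * u a) := by
  ext b
  by_cases hb : b = a
  · subst hb; simp
  · simp [hb]

theorem mul_mulSingle_eq_update {ι M : Type*} [DecidableEq ι] [MulOneClass M] (a : ι) (s : M)
    (u : ι → M) :
    u * Pi.mulSingle a s = Function.update u a (u a * s) := by
  ext b
  by_cases hb : b = a
  · subst hb; simp
  · simp [hb]

variable {R ι m : Type*} [CommSemiring R] [Fintype ι]

/-- The Kronecker product `⨂ a, u a` of a finite family of square matrices, as a multilinear map;
its rows and columns are indexed by functions `ι → m`. -/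
def piKronecker : MultilinearMap R (fun _ : ι => Matrix m m R) (Matrix (ι → m) (ι → m) R) :=
  (Matrix.ofLinearEquiv R).toLinearMap.compMultilinearMap <|
    MultilinearMap.pi fun x => MultilinearMap.pi fun y =>
      (MultilinearMap.mkPiAlgebra R ι R).compLinearMap fun a =>
        Matrix.entryLinearMap R R (x a) (y a)

theorem piKronecker_apply (u : ι → Matrix m m R) (x y : ι → m) :
    piKronecker u x y = ∏ a, u a (x a) (y a) := rfl

variable [DecidableEq ι] [Fintype m]

theorem piKronecker_mul (u v : ι → Matrix m m R) :
    piKronecker u * piKronecker v = piKronecker (u * v) := by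
  ext x y
  simp only [Matrix.mul_apply, piKronecker_apply, Pi.mul_apply, Finset.prod_univ_sum,
    Fintype.piFinset_univ, Finset.prod_mul_distrib]

variable (R ι m) in
/-- The identification of `⨂ a, Matrix m m R` with the matrices indexed by `ι → m`, defined by
matching the two bases of matrix units. -/
def piKroneckerEquiv :
    PiTensorProduct R (fun _ : ι => Matrix m m R) ≃ₗ[R] Matrix (ι → m) (ι → m) R :=
  (Basis.piTensorProduct fun _ => Matrix.stdBasis R m m).equiv
    (Matrix.stdBasis R (ι → m) (ι → m)) (Equiv.arrowProdEquivProdArrow ι (fun _ => m) fun _ => m)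

theorem piKroneckerEquiv_tprod (u : ι → Matrix m m R) :
    piKroneckerEquiv R ι m (PiTensorProduct.tprod R u) = piKronecker u := by
  classical
  suffices h : (piKroneckerEquiv R ι m).toLinearMap.compMultilinearMap (PiTensorProduct.tprod R) =
      piKronecker from DFunLike.congr_fun h u
  refine Module.Basis.ext_multilinear (fun _ => Matrix.stdBasis R m m) fun p => ?_
  have hb (q : m × m) : Matrix.stdBasis R m m q = Matrix.single q.1 q.2 1 :=
    Matrix.stdBasis_eq_single R q.1 q.2
  have hp : piKroneckerEquiv R ι m (PiTensorProduct.tprod R fun a =>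
      Matrix.single (p a).1 (p a).2 1) = Matrix.single (fun a => (p a).1) (fun a => (p a).2) 1 := by
    simp only [← hb]
    rw [← Basis.piTensorProduct_apply, piKroneckerEquiv, Module.Basis.equiv_apply]
    exact Matrix.stdBasis_eq_single R _ _
  ext x y
  simp only [LinearMap.compMultilinearMap_apply, LinearEquiv.coe_coe, hp, hb, piKronecker_apply,
    Matrix.single_apply, Finset.prod_ite_zero, Finset.prod_const_one, Finset.mem_univ,
    true_imp_iff, funext_iff, forall_and]

/-- The basis of Kronecker products of elements of a basis of the one-site matrices. -/
def piKroneckerBasis {κ : Type*} (b : Module.Basis κ R (Matrix m m R)) :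
    Module.Basis (ι → κ) R (Matrix (ι → m) (ι → m) R) :=
  (Basis.piTensorProduct fun _ => b).map (piKroneckerEquiv R ι m)

theorem piKroneckerBasis_apply {κ : Type*} (b : Module.Basis κ R (Matrix m m R)) (j : ι → κ) :
    piKroneckerBasis b j = piKronecker fun a => b (j a) := by
  rw [piKroneckerBasis, Module.Basis.map_apply, Basis.piTensorProduct_apply,
    piKroneckerEquiv_tprod]

end PiKronecker

theorem le_spectralGap_of_sum_site {ι m κ : Type*} [Fintype ι] [Nonempty ι] [DecidableEq ι]
    [Fintype m] [Finite κ] [Nontrivial κ]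
    {L : Matrix (ι → m) (ι → m) ℂ →ₗ[ℂ] Matrix (ι → m) (ι → m) ℂ}
    {G : Matrix m m ℂ →ₗ[ℂ] Matrix m m ℂ}
    (hL : ∀ u, L (piKronecker u) = ∑ a, piKronecker (Function.update u a (G (u a))))
    (b : Module.Basis κ ℂ (Matrix m m ℂ)) {μ : κ → ℂ} (hG : ∀ j, G (b j) = μ j • b j)
    {j₀ : κ} (h₀ : μ j₀ = 0) {g : ℝ} (hg₀ : 0 ≤ g) (hg : ∀ j, j ≠ j₀ → g ≤ -(μ j).re) :
    g ≤ spectralGap L := by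
  classical
  have hre (j : κ) : 0 ≤ -(μ j).re := by
    by_cases hj : j = j₀
    · simp [hj, h₀]
    · exact hg₀.trans (hg j hj)
  have heigen (j : ι → κ) :
      L (piKroneckerBasis b j) = (∑ a, μ (j a)) • piKroneckerBasis b j := by
    simp only [piKroneckerBasis_apply, hL, hG, MultilinearMap.map_update_smul, Finset.sum_smul]
    exact Finset.sum_congr rfl fun a _ => by rw [Function.update_eq_self a fun a => b (j a)]
  refine le_spectralGap_of_eigenbasis (piKroneckerBasis b) heigen (j₀ := fun _ => j₀)
    (by simp [h₀]) fun j hj => ?_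
  obtain ⟨a, ha⟩ := Function.ne_iff.1 hj
  calc g ≤ -(μ (j a)).re := hg _ ha
    _ ≤ ∑ a, -(μ (j a)).re :=
      Finset.single_le_sum (f := fun a => -(μ (j a)).re) (fun a _ => hre (j a)) (Finset.mem_univ a)
    _ = -(∑ a, μ (j a)).re := by rw [Complex.re_sum, Finset.sum_neg_distrib]
    _ ≤ ‖∑ a, μ (j a)‖ := (neg_le_abs _).trans (Complex.abs_re_le_norm _)

section Eigenoperator

theorem exp_mul_mul_exp_neg_eq_smul {𝔸 : Type*} [NormedRing 𝔸] [NormedAlgebra ℂ 𝔸]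
    [CompleteSpace 𝔸] {H S : 𝔸} {ν : ℂ} (h : ⁅H, S⁆ = ν • S) (z : ℂ) :
    NormedSpace.exp (z • H) * S * NormedSpace.exp (-z • H) = Complex.exp (z * ν) • S := by
  let : NormedAlgebra ℚ 𝔸 := NormedAlgebra.restrictScalars ℚ ℂ 𝔸
  have hsemi : SemiconjBy S (-z • H) ((z * ν) • 1 + -z • H) := by
    have hS : H * S = S * H + ν • S := by rw [← h, Ring.lie_def]; abel
    simp only [SemiconjBy, add_mul, smul_mul_assoc, mul_smul_comm, one_mul, hS]
    module
  have hcomm : Commute (z • H) ((z * ν) • 1 + -z • H) :=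
    ((Commute.one_right _).smul_right _).add_right (((Commute.refl H).smul_left _).smul_right _)
  calc NormedSpace.exp (z • H) * S * NormedSpace.exp (-z • H)
      = NormedSpace.exp (z • H) * NormedSpace.exp ((z * ν) • 1 + -z • H) * S := by
        rw [mul_assoc, hsemi.exp_right.eq, mul_assoc]
    _ = NormedSpace.exp (algebraMap ℂ 𝔸 (z * ν)) * S := by
        rw [← NormedSpace.exp_add_of_commute hcomm, Algebra.algebraMap_eq_smul_one]
        congr 2
        module
    _ = Complex.exp (z * ν) • S := by
        rw [← NormedSpace.algebraMap_exp_comm, ← Complex.exp_eq_exp_ℂ, ← Algebra.smul_def]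

variable {n κ : Type*} [Fintype n] {H : Matrix n n ℂ}

/-- `S` shifts the energy by `ν`: it is an eigenvector of `[H, ·]` for the eigenvalue `ν`. -/
def IsEigenoperator (H : Matrix n n ℂ) (ν : ℝ) (S : Matrix n n ℂ) : Prop :=
  ⁅H, S⁆ = (ν : ℂ) • S

theorem IsEigenoperator.smul {ν : ℝ} {S : Matrix n n ℂ} (h : IsEigenoperator H ν S) (c : ℂ) :
    IsEigenoperator H ν (c • S) := by
  rw [IsEigenoperator, Ring.lie_def, mul_smul_comm, smul_mul_assoc, ← smul_sub, ← Ring.lie_def, h,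
    smul_comm]

variable [DecidableEq n]

open scoped Matrix.Norms.Operator in
theorem IsEigenoperator.heisenberg_eq {ν : ℝ} {S : Matrix n n ℂ} (h : IsEigenoperator H ν S)
    (t : ℝ) : heisenberg H S t = Complex.exp (Complex.I * t * ν) • S :=
  exp_mul_mul_exp_neg_eq_smul h (Complex.I * t)

variable (hH : H.IsHermitian)

theorem IsEigenoperator.eigenbasis_apply_eq_zero {ν : ℝ} {S : Matrix n n ℂ}
    (h : IsEigenoperator H ν S) {l m : n} (hlm : hH.eigenvalues l - hH.eigenvalues m ≠ ν) :
    ((hH.eigenvectorUnitary : Matrix n n ℂ)ᴴ * S * (hH.eigenvectorUnitary : Matrix n n ℂ)) l m =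
      0 := by
  set φ := Unitary.conjStarAlgAut ℂ _ (star hH.eigenvectorUnitary)
  set D : Matrix n n ℂ := Matrix.diagonal (fun l => (hH.eigenvalues l : ℂ))
  have hφH : φ H = D := hH.conjStarAlgAut_star_eigenvectorUnitary
  have hφS : φ S = (hH.eigenvectorUnitary : Matrix n n ℂ)ᴴ * S * hH.eigenvectorUnitary :=
    Unitary.conjStarAlgAut_star_apply _ _
  have hD : D * φ S - φ S * D = (ν : ℂ) • φ S := by
    rw [← hφH, ← map_mul, ← map_mul, ← map_sub, ← map_smul, ← h, Ring.lie_def]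
  have hentry := congrFun₂ hD l m
  rw [Matrix.sub_apply, Matrix.diagonal_mul, Matrix.mul_diagonal, Matrix.smul_apply,
    smul_eq_mul] at hentry
  rw [← hφS]
  have hzero : ((hH.eigenvalues l - hH.eigenvalues m - ν : ℝ) : ℂ) * φ S l m = 0 := by
    push_cast
    linear_combination hentry
  exact (mul_eq_zero.1 hzero).resolve_left (Complex.ofReal_ne_zero.2 (sub_ne_zero.2 hlm))

theorem IsEigenoperator.bohrComponent_eq {ν : ℝ} {S : Matrix n n ℂ} (h : IsEigenoperator H ν S)
    (ω : ℝ) : bohrComponent hH S ω = if ν = ω then S else 0 := by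
  have hentries : (Matrix.of fun l m => if hH.eigenvalues l - hH.eigenvalues m = ω then
      ((hH.eigenvectorUnitary : Matrix n n ℂ)ᴴ * S * (hH.eigenvectorUnitary : Matrix n n ℂ)) l m
      else 0) = if ν = ω then
        (hH.eigenvectorUnitary : Matrix n n ℂ)ᴴ * S * (hH.eigenvectorUnitary : Matrix n n ℂ)
      else 0 := by
    ext l m
    have hzero := h.eigenbasis_apply_eq_zero hH (l := l) (m := m)
    grind [Matrix.of_apply, Matrix.zero_apply]
  have hconj : (hH.eigenvectorUnitary : Matrix n n ℂ) * ((hH.eigenvectorUnitary : Matrix n n ℂ)ᴴ *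
      S * (hH.eigenvectorUnitary : Matrix n n ℂ)) * (hH.eigenvectorUnitary : Matrix n n ℂ)ᴴ = S :=
    (Unitary.conjStarAlgAut ℂ _ hH.eigenvectorUnitary).apply_symm_apply S
  rw [bohrComponent, hentries]
  split_ifs
  · exact hconj
  · rw [mul_zero, zero_mul]

theorem bohrComponent_sum [Fintype κ] (S : κ → Matrix n n ℂ) (ω : ℝ) :
    bohrComponent hH (∑ k, S k) ω = ∑ k, bohrComponent hH (S k) ω := by
  simp only [bohrComponent, ← Finset.sum_mul, ← Finset.mul_sum]
  congr 2
  ext l m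
  simp only [Matrix.of_apply, Matrix.sum_apply, Finset.mul_sum, Finset.sum_mul]
  split_ifs
  · rfl
  · simp only [Finset.sum_const_zero]

theorem heisenberg_sum [Fintype κ] (S : κ → Matrix n n ℂ) (t : ℝ) :
    heisenberg H (∑ k, S k) t = ∑ k, heisenberg H (S k) t := by
  simp only [heisenberg, Finset.mul_sum, Finset.sum_mul]

end Eigenoperator

section Filters

open MeasureTheory

theorem filter_normalization {σ : ℝ} (hσ : 0 < σ) :
    1 / Real.sqrt (2 * Real.pi) * (Real.sqrt (σ * Real.sqrt (2 / Real.pi)) *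
      Real.sqrt (Real.pi / σ ^ 2)) = 1 / Real.sqrt (σ * Real.sqrt (2 * Real.pi)) := by
  have hdiv : Real.sqrt (2 / Real.pi) = 2 / Real.sqrt (2 * Real.pi) := by
    rw [Real.sqrt_eq_iff_mul_self_eq_of_pos (by positivity), div_mul_div_comm,
      Real.mul_self_sqrt (by positivity)]
    field_simp
  rw [← sq_eq_sq₀ (by positivity) (by positivity), mul_pow, mul_pow, div_pow, div_pow,
    Real.sq_sqrt (by positivity), Real.sq_sqrt (by positivity), Real.sq_sqrt (by positivity),
    Real.sq_sqrt (by positivity), hdiv]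
  field_simp

theorem cexp_mul_timeFilter (σ ξ t : ℝ) :
    Complex.exp (Complex.I * ξ * t) * (timeFilter σ t : ℂ) =
      (Real.sqrt (σ * Real.sqrt (2 / Real.pi)) : ℂ) *
        (Complex.exp (Complex.I * ξ * t) * Complex.exp (-((σ ^ 2 : ℝ) : ℂ) * t ^ 2)) := by
  rw [timeFilter]
  push_cast
  ring

theorem integrable_cexp_mul_timeFilter {σ : ℝ} (hσ : 0 < σ) (ξ : ℝ) :
    Integrable fun t : ℝ => Complex.exp (Complex.I * ξ * t) * (timeFilter σ t : ℂ) := by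
  simp only [cexp_mul_timeFilter, ← Complex.exp_add]
  have hquad := integrable_cexp_quadratic (b := ((σ ^ 2 : ℝ) : ℂ))
    (by rw [Complex.ofReal_re]; positivity) (Complex.I * ξ) 0
  exact Integrable.const_mul (hquad.congr (.of_forall fun t => by ring_nf)) _

theorem integral_cexp_mul_timeFilter {σ : ℝ} (hσ : 0 < σ) (ξ : ℝ) :
    ((1 / Real.sqrt (2 * Real.pi) : ℝ) : ℂ) *
      ∫ t : ℝ, Complex.exp (Complex.I * ξ * t) * (timeFilter σ t : ℂ) = (freqFilter σ ξ : ℂ) := by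
  have hsqrt : ((Real.pi : ℂ) / ((σ ^ 2 : ℝ) : ℂ)) ^ (1 / 2 : ℂ) =
      ((Real.sqrt (Real.pi / σ ^ 2) : ℝ) : ℂ) := by
    rw [Real.sqrt_eq_rpow, Complex.ofReal_cpow (by positivity)]
    push_cast
    rfl
  simp only [cexp_mul_timeFilter]
  rw [integral_const_mul, fourierIntegral_gaussian (by rw [Complex.ofReal_re]; positivity), hsqrt,
    freqFilter, ← filter_normalization hσ]
  push_cast
  ring

theorem freqFilter_neg (σ ω : ℝ) : freqFilter σ (-ω) = freqFilter σ ω := by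
  simp only [freqFilter, neg_sq]

theorem oft_sum {n κ : Type*} [Fintype n] [DecidableEq n] [Fintype κ] {σ : ℝ} (hσ : 0 < σ)
    {H : Matrix n n ℂ} {ν : κ → ℝ} {S : κ → Matrix n n ℂ}
    (h : ∀ k, IsEigenoperator H (ν k) (S k)) (ω : ℝ) :
    oft σ H (∑ k, S k) ω = ∑ k, (freqFilter σ (ω - ν k) : ℂ) • S k := by
  ext i j
  have hintegrand (t : ℝ) : heisenberg H (∑ k, S k) t i j *
      Complex.exp (-(Complex.I * (ω : ℂ) * (t : ℂ))) * (timeFilter σ t : ℂ) =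
      ∑ k, Complex.exp (Complex.I * (ν k - ω : ℝ) * t) * (timeFilter σ t : ℂ) * S k i j := by
    simp only [heisenberg_sum, (h _).heisenberg_eq, Matrix.sum_apply, Matrix.smul_apply,
      smul_eq_mul, Finset.sum_mul]
    refine Finset.sum_congr rfl fun k _ => ?_
    have hexp : Complex.exp (Complex.I * (ν k - ω : ℝ) * t) =
        Complex.exp (Complex.I * t * ν k) * Complex.exp (-(Complex.I * ω * t)) := by
      rw [← Complex.exp_add]
      push_cast
      ring_nf
    rw [hexp]
    ring
  simp only [oft, Matrix.of_apply, hintegrand]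
  rw [integral_finsetSum _ fun k _ => (integrable_cexp_mul_timeFilter hσ _).mul_const _,
    Finset.mul_sum, Matrix.sum_apply]
  refine Finset.sum_congr rfl fun k _ => ?_
  rw [integral_mul_const, ← mul_assoc, integral_cexp_mul_timeFilter hσ, ← neg_sub ω (ν k),
    freqFilter_neg, Matrix.smul_apply, smul_eq_mul]

end Filters

section Theta

open MeasureTheory

theorem metropolis_pos (β σ ω : ℝ) : 0 < metropolis β σ ω := Real.exp_pos _

theorem continuous_metropolis (β σ : ℝ) : Continuous (metropolis β σ) := by
  unfold metropolis
  fun_prop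

theorem metropolis_le (β σ ω : ℝ) :
    metropolis β σ ω ≤ 1 + Real.exp (-β * (ω + β * σ ^ 2 / 2)) := by
  rw [metropolis]
  rcases max_choice (ω + β * σ ^ 2 / 2) 0 with h | h <;> rw [h]
  · exact le_add_of_nonneg_left zero_le_one
  · rw [mul_zero, Real.exp_zero]
    exact le_add_of_nonneg_right (Real.exp_pos _).le

theorem freqFilter_pos {σ : ℝ} (hσ : 0 < σ) (ω : ℝ) : 0 < freqFilter σ ω := by
  unfold freqFilter
  positivity

theorem freqFilter_lt_freqFilter_zero {σ ω : ℝ} (hσ : 0 < σ) (hω : ω ≠ 0) :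
    freqFilter σ ω < freqFilter σ 0 := by
  have hexponent : -ω ^ 2 / (4 * σ ^ 2) < -0 ^ 2 / (4 * σ ^ 2) :=
    div_lt_div_of_pos_right (by simpa [sq_pos_iff] using hω) (by positivity)
  exact mul_lt_mul_of_pos_left (Real.exp_lt_exp.2 hexponent) (by positivity)

theorem freqFilter_le_freqFilter_zero {σ : ℝ} (hσ : 0 < σ) (ω : ℝ) :
    freqFilter σ ω ≤ freqFilter σ 0 := by
  rcases eq_or_ne ω 0 with rfl | hω
  · exact le_rfl
  · exact (freqFilter_lt_freqFilter_zero hσ hω).le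

theorem continuous_freqFilter (σ : ℝ) : Continuous (freqFilter σ) := by
  unfold freqFilter
  fun_prop

theorem integrable_freqFilter_mul_exp {σ : ℝ} (hσ : 0 < σ) (ν b c : ℝ) :
    Integrable fun ω => freqFilter σ (ω - ν) * Real.exp (b * ω + c) := by
  have hquad := (integrable_cexp_quadratic (b := ((1 / (4 * σ ^ 2) : ℝ) : ℂ))
    (by rw [Complex.ofReal_re]; positivity) ((ν / (2 * σ ^ 2) + b : ℝ) : ℂ)
    ((c - ν ^ 2 / (4 * σ ^ 2) : ℝ) : ℂ)).norm
  refine (hquad.const_mul (1 / Real.sqrt (σ * Real.sqrt (2 * Real.pi)))).congr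
    (.of_forall fun ω => ?_)
  simp only [Complex.norm_exp, freqFilter, mul_assoc, ← Real.exp_add]
  congr 2
  norm_cast
  field_simp
  ring

theorem integrable_theta_integrand {σ : ℝ} (hσ : 0 < σ) (β ν₁ ν₂ : ℝ) :
    Integrable fun ω : ℝ =>
      freqFilter σ (ω - ν₁) * freqFilter σ (ω - ν₂) * metropolis β σ ω := by
  have hcf := continuous_freqFilter σ
  have hcm := continuous_metropolis β σ
  have hdom : Integrable fun ω : ℝ => freqFilter σ 0 *
      (freqFilter σ (ω - ν₁) * (1 + Real.exp (-β * (ω + β * σ ^ 2 / 2)))) := by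
    have h₀ := integrable_freqFilter_mul_exp hσ ν₁ 0 0
    have h₁ := integrable_freqFilter_mul_exp hσ ν₁ (-β) (-β * (β * σ ^ 2 / 2))
    refine ((h₀.add h₁).const_mul (freqFilter σ 0)).congr (.of_forall fun ω => ?_)
    simp only [Pi.add_apply, zero_mul, add_zero, Real.exp_zero, mul_add]
  refine hdom.mono' (by fun_prop) (.of_forall fun ω => ?_)
  have h₁ := freqFilter_pos hσ (ω - ν₁)
  have h₂ := freqFilter_pos hσ (ω - ν₂)
  have hm := metropolis_pos β σ ω
  rw [Real.norm_of_nonneg (by positivity), mul_right_comm, mul_comm (freqFilter σ 0)]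
  gcongr
  · exact metropolis_le β σ ω
  · exact freqFilter_le_freqFilter_zero hσ _

theorem theta_comm (β σ ν₁ ν₂ : ℝ) : theta β σ ν₁ ν₂ = theta β σ ν₂ ν₁ := by
  simp only [theta, mul_comm (freqFilter σ (_ - ν₁))]

theorem theta_nonneg {σ : ℝ} (hσ : 0 < σ) (β ν₁ ν₂ : ℝ) : 0 ≤ theta β σ ν₁ ν₂ :=
  integral_nonneg fun ω => mul_nonneg
    (mul_nonneg (freqFilter_pos hσ _).le (freqFilter_pos hσ _).le) (metropolis_pos β σ ω).le

theorem two_mul_theta_lt {σ ν₁ ν₂ : ℝ} (hσ : 0 < σ) (β : ℝ) (hν : ν₁ ≠ ν₂) :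
    2 * theta β σ ν₁ ν₂ < theta β σ ν₁ ν₁ + theta β σ ν₂ ν₂ := by
  set F : ℝ → ℝ := fun ω =>
    (freqFilter σ (ω - ν₁) - freqFilter σ (ω - ν₂)) ^ 2 * metropolis β σ ω
  have hexpand : F = fun ω =>
      freqFilter σ (ω - ν₁) * freqFilter σ (ω - ν₁) * metropolis β σ ω +
        freqFilter σ (ω - ν₂) * freqFilter σ (ω - ν₂) * metropolis β σ ω -
        2 * (freqFilter σ (ω - ν₁) * freqFilter σ (ω - ν₂) * metropolis β σ ω) := by
    ext ω
    ring
  have h₁ := integrable_theta_integrand hσ β ν₁ ν₁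
  have h₂ := integrable_theta_integrand hσ β ν₂ ν₂
  have h₁₂ := (integrable_theta_integrand hσ β ν₁ ν₂).const_mul 2
  have hint : Integrable F := hexpand ▸ (h₁.add h₂).sub h₁₂
  have hval : ∫ ω, F ω = theta β σ ν₁ ν₁ + theta β σ ν₂ ν₂ - 2 * theta β σ ν₁ ν₂ := by
    rw [hexpand]
    refine (integral_sub (h₁.add h₂) h₁₂).trans ?_
    rw [integral_const_mul]
    exact congrArg (· - _) (integral_add h₁ h₂)
  have hcont : Continuous F := by
    have hcf := continuous_freqFilter σ
    have hcm := continuous_metropolis β σ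
    fun_prop
  have hne : F ν₁ ≠ 0 := by
    refine mul_ne_zero (pow_ne_zero 2 (sub_ne_zero.2 ?_)) (metropolis_pos β σ ν₁).ne'
    rw [sub_self]
    exact (freqFilter_lt_freqFilter_zero hσ (sub_ne_zero.2 hν)).ne'
  have hpos : 0 < ∫ ω, F ω := integral_pos_of_integrable_nonneg_nonzero hcont hint
    (fun ω => mul_nonneg (sq_nonneg _) (metropolis_pos β σ ω).le) hne
  linarith

end Theta

section Superoperators

variable {n κ : Type*} [Fintype n] [Fintype κ]

/-- The sesquilinear polarization of the dissipator: the superoperator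
`X ↦ K X L† - ½ (L† K X + X L† K)`, linear in `K` and conjugate-linear in `L`. -/
def polarDissipator :
    Matrix n n ℂ →ₗ[ℂ] Matrix n n ℂ →ₗ⋆[ℂ] Matrix n n ℂ →ₗ[ℂ] Matrix n n ℂ :=
  LinearMap.mk₂'ₛₗ _ _
    (fun K L =>
      { toFun := fun X => K * X * Lᴴ - (1 / 2 : ℂ) • (Lᴴ * K * X + X * (Lᴴ * K))
        map_add' := fun X Y => by
          simp only [mul_add, add_mul]
          module
        map_smul' := fun c X => by
          simp only [mul_smul_comm, smul_mul_assoc, RingHom.id_apply]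
          module })
    (fun K K' L => LinearMap.ext fun X => by
      simp only [LinearMap.coe_mk, AddHom.coe_mk, LinearMap.add_apply, mul_add, add_mul]
      module)
    (fun c K L => LinearMap.ext fun X => by
      simp only [LinearMap.coe_mk, AddHom.coe_mk, LinearMap.smul_apply, mul_smul_comm,
        smul_mul_assoc, RingHom.id_apply]
      module)
    (fun K L L' => LinearMap.ext fun X => by
      simp only [LinearMap.coe_mk, AddHom.coe_mk, LinearMap.add_apply,
        Matrix.conjTranspose_add, mul_add, add_mul]
      module)
    (fun c K L => LinearMap.ext fun X => by
      simp only [LinearMap.coe_mk, AddHom.coe_mk, LinearMap.smul_apply,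
        Matrix.conjTranspose_smul, mul_smul_comm, smul_mul_assoc, starRingEnd_apply]
      module)

theorem polarDissipator_apply (K L X : Matrix n n ℂ) :
    polarDissipator K L X = K * X * Lᴴ - (1 / 2 : ℂ) • (Lᴴ * K * X + X * (Lᴴ * K)) := rfl

theorem polarDissipator_smul_smul (c z : ℂ) (K L : Matrix n n ℂ) :
    polarDissipator (c • K) (z • L) = (c * starRingEnd ℂ z) • polarDissipator K L := by
  simp only [map_smulₛₗ, LinearMap.smul_apply, smul_smul, RingHom.id_apply, mul_comm]

variable [DecidableEq n]

theorem polarDissipator_self (K : Matrix n n ℂ) : polarDissipator K K = dissipator K := rfl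

theorem dissipator_sum_smul (c : κ → ℂ) (S : κ → Matrix n n ℂ) :
    dissipator (∑ k, c k • S k) =
      ∑ k, ∑ l, (c k * starRingEnd ℂ (c l)) • polarDissipator (S k) (S l) := by
  rw [Finset.sum_comm]
  simp only [← polarDissipator_self, map_sum, LinearMap.sum_apply, polarDissipator_smul_smul]

theorem commutatorPart_zero : commutatorPart (0 : Matrix n n ℂ) = 0 :=
  LinearMap.ext fun X => by simp [commutatorPart]

theorem integralSuperop_sum_smul {c : κ → ℝ → ℂ}
    (hc : ∀ k, MeasureTheory.Integrable (c k)) (T : κ → Matrix n n ℂ →ₗ[ℂ] Matrix n n ℂ) :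
    integralSuperop (fun ω => ∑ k, c k ω • T k) = ∑ k, (∫ ω, c k ω) • T k := by
  rw [integralSuperop, ← LinearEquiv.eq_symm_apply, Matrix.toLin_symm]
  ext p q
  simp only [Matrix.of_apply, map_sum, map_smul, Matrix.sum_apply, Matrix.smul_apply, smul_eq_mul]
  rw [MeasureTheory.integral_finsetSum _ fun k _ => (hc k).mul_const _]
  simp only [MeasureTheory.integral_mul_const]

end Superoperators

section LindbladianOfEigenoperators

variable {n ι κ : Type*} [Fintype n] [DecidableEq n] [Fintype ι] [Fintype κ]
  {H : Matrix n n ℂ} {ν : ι → κ → ℝ} {S : ι → κ → Matrix n n ℂ}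

theorem coherentTerm_eq_zero (β σ : ℝ) (hH : H.IsHermitian)
    (hS : ∀ a k, IsEigenoperator H (ν a k) (S a k))
    (hperp : ∀ a, Pairwise fun k l => (S a k)ᴴ * S a l = 0) :
    coherentTerm β σ hH (fun a => ∑ k, S a k) = 0 := by
  refine Finset.sum_eq_zero fun a _ => Finset.sum_eq_zero fun ν₁ _ =>
    Finset.sum_eq_zero fun ν₂ _ => ?_
  rcases eq_or_ne ν₁ ν₂ with rfl | hν
  · simp
  · have hprod : (bohrComponent hH (∑ k, S a k) ν₂)ᴴ * bohrComponent hH (∑ k, S a k) ν₁ = 0 := by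
      simp only [bohrComponent_sum, (hS a _).bohrComponent_eq, Matrix.conjTranspose_sum,
        Finset.sum_mul_sum]
      refine Finset.sum_eq_zero fun k _ => Finset.sum_eq_zero fun l _ => ?_
      rcases eq_or_ne k l with rfl | hkl
      · grind [Matrix.conjTranspose_zero]
      · have := hperp a hkl
        split_ifs <;> simp [this]
    rw [hprod, smul_zero]

theorem integralSuperop_metropolis_smul_dissipator_oft {σ : ℝ} (hσ : 0 < σ) (β : ℝ) {ν : κ → ℝ}
    {S : κ → Matrix n n ℂ} (hS : ∀ k, IsEigenoperator H (ν k) (S k)) :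
    integralSuperop (fun ω => (metropolis β σ ω : ℂ) • dissipator (oft σ H (∑ k, S k) ω)) =
      ∑ k, ∑ l, (theta β σ (ν k) (ν l) : ℂ) • polarDissipator (S k) (S l) := by
  have hexpand (ω : ℝ) : (metropolis β σ ω : ℂ) • dissipator (oft σ H (∑ k, S k) ω) =
      ∑ p : κ × κ, ((freqFilter σ (ω - ν p.1) * freqFilter σ (ω - ν p.2) *
        metropolis β σ ω : ℝ) : ℂ) • polarDissipator (S p.1) (S p.2) := by
    rw [oft_sum hσ hS, dissipator_sum_smul, Fintype.sum_prod_type]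
    simp only [Complex.conj_ofReal, Finset.smul_sum, smul_smul, ← Complex.ofReal_mul,
      mul_comm (metropolis β σ ω)]
  have hintegrable (p : κ × κ) : MeasureTheory.Integrable fun ω =>
      ((freqFilter σ (ω - ν p.1) * freqFilter σ (ω - ν p.2) * metropolis β σ ω : ℝ) : ℂ) :=
    (integrable_theta_integrand hσ β (ν p.1) (ν p.2)).ofReal
  rw [funext hexpand, integralSuperop_sum_smul hintegrable fun p => polarDissipator (S p.1) (S p.2),
    Fintype.sum_prod_type]
  simp only [integral_complex_ofReal, theta]

theorem lindbladian_eq_sum_polarDissipator {σ : ℝ} (hσ : 0 < σ) (β : ℝ) (hH : H.IsHermitian)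
    (hS : ∀ a k, IsEigenoperator H (ν a k) (S a k))
    (hperp : ∀ a, Pairwise fun k l => (S a k)ᴴ * S a l = 0) :
    lindbladian β σ hH (fun a => ∑ k, S a k) =
      ∑ a, ∑ k, ∑ l, (theta β σ (ν a k) (ν a l) : ℂ) • polarDissipator (S a k) (S a l) := by
  rw [lindbladian, coherentTerm_eq_zero β σ hH hS hperp, commutatorPart_zero, zero_add]
  exact Finset.sum_congr rfl fun a _ =>
    integralSuperop_metropolis_smul_dissipator_oft hσ β (hS a)

end LindbladianOfEigenoperators

section SiteOperators

variable {d : ℕ}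

theorem siteOp_eq_piKronecker (M : Matrix (Fin 2) (Fin 2) ℂ) (a : Fin d) :
    siteOp M a = piKronecker (Pi.mulSingle a M) := by
  ext x y
  rw [siteOp, Matrix.of_apply, piKronecker_apply, ← Finset.mul_prod_erase _ _ (Finset.mem_univ a),
    Pi.mulSingle_eq_same]
  have hone : ∏ b ∈ Finset.univ.erase a, (Pi.mulSingle a M : Fin d → _) b (x b) (y b) =
      ∏ b ∈ Finset.univ.erase a, if x b = y b then 1 else 0 :=
    Finset.prod_congr rfl fun b hb => by
      rw [Pi.mulSingle_eq_of_ne (Finset.ne_of_mem_erase hb), Matrix.one_apply]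
  simp only [hone, Finset.prod_ite_zero, Finset.prod_const_one, Finset.mem_erase, Finset.mem_univ,
    and_true, mul_ite, mul_one, mul_zero]

theorem siteOp_mul_piKronecker (M : Matrix (Fin 2) (Fin 2) ℂ) (a : Fin d)
    (u : Fin d → Matrix (Fin 2) (Fin 2) ℂ) :
    siteOp M a * piKronecker u = piKronecker (Function.update u a (M * u a)) := by
  rw [siteOp_eq_piKronecker, piKronecker_mul, mulSingle_mul_eq_update]

theorem piKronecker_mul_siteOp (M : Matrix (Fin 2) (Fin 2) ℂ) (a : Fin d)
    (u : Fin d → Matrix (Fin 2) (Fin 2) ℂ) :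
    piKronecker u * siteOp M a = piKronecker (Function.update u a (u a * M)) := by
  rw [siteOp_eq_piKronecker, piKronecker_mul, mul_mulSingle_eq_update]

theorem siteOp_mul_siteOp (M N : Matrix (Fin 2) (Fin 2) ℂ) (a : Fin d) :
    siteOp M a * siteOp N a = siteOp (M * N) a := by
  simp only [siteOp_eq_piKronecker, piKronecker_mul, ← Pi.mulSingle_mul]

theorem commute_siteOp (M N : Matrix (Fin 2) (Fin 2) ℂ) {a b : Fin d} (hab : a ≠ b) :
    Commute (siteOp M a) (siteOp N b) := by
  rw [commute_iff_eq, siteOp_eq_piKronecker, siteOp_eq_piKronecker, piKronecker_mul,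
    piKronecker_mul]
  exact congrArg piKronecker (Pi.mulSingle_commute (f := fun _ => _) hab M N)

theorem siteOp_sub (M N : Matrix (Fin 2) (Fin 2) ℂ) (a : Fin d) :
    siteOp (M - N) a = siteOp M a - siteOp N a := by
  simp only [siteOp_eq_piKronecker, Pi.mulSingle, MultilinearMap.map_update_sub]

theorem siteOp_add (M N : Matrix (Fin 2) (Fin 2) ℂ) (a : Fin d) :
    siteOp (M + N) a = siteOp M a + siteOp N a := by
  simp only [siteOp_eq_piKronecker, Pi.mulSingle, MultilinearMap.map_update_add]

theorem siteOp_smul (c : ℂ) (M : Matrix (Fin 2) (Fin 2) ℂ) (a : Fin d) :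
    siteOp (c • M) a = c • siteOp M a := by
  simp only [siteOp_eq_piKronecker, Pi.mulSingle, MultilinearMap.map_update_smul]

theorem siteOp_zero (a : Fin d) : siteOp 0 a = 0 := by
  simpa using siteOp_smul 0 0 a

theorem conjTranspose_siteOp (M : Matrix (Fin 2) (Fin 2) ℂ) (a : Fin d) :
    (siteOp M a)ᴴ = siteOp Mᴴ a := by
  ext x y
  simp only [siteOp, Matrix.conjTranspose_apply, Matrix.of_apply, eq_comm (a := x _)]
  split_ifs <;> simp

theorem polarDissipator_siteOp_piKronecker (S T : Matrix (Fin 2) (Fin 2) ℂ) (a : Fin d)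
    (u : Fin d → Matrix (Fin 2) (Fin 2) ℂ) :
    polarDissipator (siteOp S a) (siteOp T a) (piKronecker u) =
      piKronecker (Function.update u a (polarDissipator S T (u a))) := by
  simp only [polarDissipator_apply, conjTranspose_siteOp, siteOp_mul_siteOp,
    siteOp_mul_piKronecker, piKronecker_mul_siteOp, Function.update_self, Function.update_idem,
    MultilinearMap.map_update_sub, MultilinearMap.map_update_smul, MultilinearMap.map_update_add]

theorem IsEigenoperator.siteOp {M : Matrix (Fin 2) (Fin 2) ℂ} {ν : ℝ}
    (h : IsEigenoperator pauliX ν M) (a : Fin d) :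
    IsEigenoperator (hypercubeHamiltonian d) ν (siteOp M a) := by
  rw [IsEigenoperator, hypercubeHamiltonian, Ring.lie_def, Finset.sum_mul, Finset.mul_sum,
    ← Finset.sum_sub_distrib, Finset.sum_eq_single_of_mem a (Finset.mem_univ a)
      fun b _ hb => sub_eq_zero.2 (commute_siteOp _ _ hb),
    siteOp_mul_siteOp, siteOp_mul_siteOp, ← siteOp_sub, ← Ring.lie_def, h, siteOp_smul]

end SiteOperators

section Qubit

/-- The part `|+⟩⟨-|` of `Z`, which raises the energy of a qubit with Hamiltonian `X` by `2`. -/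
def raising : Matrix (Fin 2) (Fin 2) ℂ := !![1 / 2, -1 / 2; 1 / 2, -1 / 2]

/-- The part `|-⟩⟨+|` of `Z`, which lowers the energy of a qubit with Hamiltonian `X` by `2`. -/
def lowering : Matrix (Fin 2) (Fin 2) ℂ := !![1 / 2, 1 / 2; -1 / 2, -1 / 2]

theorem raising_add_lowering : raising + lowering = pauliZ := by
  ext i j
  fin_cases i <;> fin_cases j <;> norm_num [raising, lowering, pauliZ]

theorem conjTranspose_raising : raisingᴴ = lowering := by
  ext i j
  fin_cases i <;> fin_cases j <;> simp [raising, lowering]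

theorem conjTranspose_lowering : loweringᴴ = raising := by
  rw [← conjTranspose_raising, Matrix.conjTranspose_conjTranspose]

theorem raising_mul_raising : raising * raising = 0 := by
  ext i j
  fin_cases i <;> fin_cases j <;> norm_num [raising]

theorem lowering_mul_lowering : lowering * lowering = 0 := by
  ext i j
  fin_cases i <;> fin_cases j <;> norm_num [lowering]

theorem isEigenoperator_raising : IsEigenoperator pauliX 2 raising := by
  rw [IsEigenoperator, Ring.lie_def]
  ext i j
  fin_cases i <;> fin_cases j <;> norm_num [raising, pauliX]

theorem isEigenoperator_lowering : IsEigenoperator pauliX (-2) lowering := by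
  rw [IsEigenoperator, Ring.lie_def]
  ext i j
  fin_cases i <;> fin_cases j <;> norm_num [lowering, pauliX]

/-- The raising and lowering parts of `Z`, as a family indexed by `Fin 2`. -/
def ladder : Fin 2 → Matrix (Fin 2) (Fin 2) ℂ := ![raising, lowering]

theorem isEigenoperator_ladder (k : Fin 2) : IsEigenoperator pauliX (![2, -2] k) (ladder k) := by
  fin_cases k
  exacts [isEigenoperator_raising, isEigenoperator_lowering]

theorem conjTranspose_ladder_mul_ladder {k l : Fin 2} (hkl : k ≠ l) :
    (ladder k)ᴴ * ladder l = 0 := by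
  fin_cases k <;> fin_cases l <;>
    simp [ladder, conjTranspose_raising, conjTranspose_lowering, raising_mul_raising,
      lowering_mul_lowering] at hkl ⊢

/-- The generator of one qubit with pumping rate `p`, decay rate `q` and coherence transfer
rate `k`. -/
def qubitGenerator (p q k : ℂ) : Matrix (Fin 2) (Fin 2) ℂ →ₗ[ℂ] Matrix (Fin 2) (Fin 2) ℂ :=
  p • polarDissipator raising raising + q • polarDissipator lowering lowering +
    k • (polarDissipator raising lowering + polarDissipator lowering raising)

theorem qubitGenerator_apply (p q k : ℂ) (X : Matrix (Fin 2) (Fin 2) ℂ) :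
    qubitGenerator p q k X =
      p • (raising * X * lowering -
        (1 / 2 : ℂ) • (lowering * raising * X + X * (lowering * raising))) +
      q • (lowering * X * raising -
        (1 / 2 : ℂ) • (raising * lowering * X + X * (raising * lowering))) +
      k • (raising * X * raising + lowering * X * lowering) := by
  simp only [qubitGenerator, LinearMap.add_apply, LinearMap.smul_apply, polarDissipator_apply,
    conjTranspose_raising, conjTranspose_lowering, raising_mul_raising, lowering_mul_lowering,
    zero_mul, mul_zero, add_zero, smul_zero, sub_zero]

theorem qubitGenerator_one (p q k : ℂ) : qubitGenerator p q k 1 = (p - q) • pauliX := by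
  rw [qubitGenerator_apply]
  ext a b
  fin_cases a <;> fin_cases b <;> simp [raising, lowering, pauliX] <;> ring

theorem qubitGenerator_pauliX (p q k : ℂ) :
    qubitGenerator p q k pauliX = -(p + q) • pauliX := by
  rw [qubitGenerator_apply]
  ext a b
  fin_cases a <;> fin_cases b <;> simp [raising, lowering, pauliX] <;> ring

theorem qubitGenerator_pauliZ (p q k : ℂ) :
    qubitGenerator p q k pauliZ = (-(p + q) / 2 + k) • pauliZ := by
  rw [qubitGenerator_apply]
  ext a b
  fin_cases a <;> fin_cases b <;> simp [raising, lowering, pauliZ] <;> ring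

theorem qubitGenerator_pauliX_mul_pauliZ (p q k : ℂ) :
    qubitGenerator p q k (pauliX * pauliZ) = (-(p + q) / 2 - k) • (pauliX * pauliZ) := by
  rw [qubitGenerator_apply]
  ext a b
  fin_cases a <;> fin_cases b <;> simp [raising, lowering, pauliX, pauliZ] <;> ring

/-- The eigenoperators of the generator of one qubit; `r` is the polarization of its stationary
state, which is proportional to the first of them. -/
def qubitEigenop (r : ℂ) : Fin 4 → Matrix (Fin 2) (Fin 2) ℂ :=
  ![1 + r • pauliX, pauliX, pauliZ, pauliX * pauliZ]

/-- The eigenvalues of the generator of one qubit, in the order of `qubitEigenop`. -/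
def qubitEigenvalue (p q k : ℂ) : Fin 4 → ℂ :=
  ![0, -(p + q), -(p + q) / 2 + k, -(p + q) / 2 - k]

theorem qubitGenerator_qubitEigenop {p q : ℂ} (hpq : p + q ≠ 0) (k : ℂ) (j : Fin 4) :
    qubitGenerator p q k (qubitEigenop ((p - q) / (p + q)) j) =
      qubitEigenvalue p q k j • qubitEigenop ((p - q) / (p + q)) j := by
  fin_cases j
  · change qubitGenerator p q k (1 + ((p - q) / (p + q)) • pauliX) = (0 : ℂ) • _
    rw [map_add, map_smul, qubitGenerator_one, qubitGenerator_pauliX, smul_smul, ← add_smul,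
      mul_neg, div_mul_cancel₀ _ hpq, add_neg_cancel, zero_smul, zero_smul]
  exacts [qubitGenerator_pauliX p q k, qubitGenerator_pauliZ p q k,
    qubitGenerator_pauliX_mul_pauliZ p q k]

theorem le_neg_re_qubitEigenvalue {p q k : ℝ} (hk : 0 ≤ k) (hlt : 2 * k < p + q) {j : Fin 4}
    (hj : j ≠ 0) : (p + q) / 2 - k ≤ -(qubitEigenvalue p q k j).re := by
  fin_cases j
  · exact absurd rfl hj
  all_goals
    simp only [qubitEigenvalue, Fin.isValue, Fin.mk_one, Fin.reduceFinMk, Matrix.cons_val,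
      Complex.add_re, Complex.sub_re, Complex.neg_re, Complex.div_ofNat_re, Complex.ofReal_re]
    linarith

theorem linearIndependent_qubitEigenop (r : ℂ) : LinearIndependent ℂ (qubitEigenop r) := by
  rw [Fintype.linearIndependent_iff]
  intro g hg
  have hsum : ∑ j, g j • qubitEigenop r j =
      !![g 0 + g 2, g 0 * r + g 1 - g 3; g 0 * r + g 1 + g 3, g 0 - g 2] := by
    rw [Fin.sum_univ_four]
    ext a b
    fin_cases a <;> fin_cases b <;> simp [qubitEigenop, pauliX, pauliZ] <;> ring
  rw [hsum] at hg
  have h₀₀ : g 0 + g 2 = 0 := congrFun₂ hg 0 0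
  have h₀₁ : g 0 * r + g 1 - g 3 = 0 := congrFun₂ hg 0 1
  have h₁₀ : g 0 * r + g 1 + g 3 = 0 := congrFun₂ hg 1 0
  have h₁₁ : g 0 - g 2 = 0 := congrFun₂ hg 1 1
  intro i
  fin_cases i <;> grind

/-- The eigenbasis of the generator of one qubit. -/
def qubitEigenbasis (r : ℂ) : Module.Basis (Fin 4) ℂ (Matrix (Fin 2) (Fin 2) ℂ) :=
  basisOfLinearIndependentOfCardEqFinrank (linearIndependent_qubitEigenop r)
    (by simp [Module.finrank_matrix])

theorem qubitEigenbasis_apply (r : ℂ) (j : Fin 4) : qubitEigenbasis r j = qubitEigenop r j := by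
  rw [qubitEigenbasis, coe_basisOfLinearIndependentOfCardEqFinrank]

end Qubit

section Hypercube

variable {d : ℕ}

theorem hypercubeJump_eq_sum (a : Fin d) :
    hypercubeJump d a = ∑ k, ((1 / Real.sqrt d : ℝ) : ℂ) • siteOp (ladder k) a := by
  rw [hypercubeJump, ← raising_add_lowering, siteOp_add, smul_add, Fin.sum_univ_two]
  rfl

theorem polarDissipator_smul_siteOp_piKronecker (S T : Matrix (Fin 2) (Fin 2) ℂ) (a : Fin d)
    (u : Fin d → Matrix (Fin 2) (Fin 2) ℂ) :
    polarDissipator (((1 / Real.sqrt d : ℝ) : ℂ) • siteOp S a)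
        (((1 / Real.sqrt d : ℝ) : ℂ) • siteOp T a) (piKronecker u) =
      (d : ℂ)⁻¹ • piKronecker (Function.update u a (polarDissipator S T (u a))) := by
  have hscale : ((1 / Real.sqrt d : ℝ) : ℂ) * starRingEnd ℂ ((1 / Real.sqrt d : ℝ) : ℂ) =
      (d : ℂ)⁻¹ := by
    rw [Complex.conj_ofReal, ← Complex.ofReal_mul, div_mul_div_comm,
      Real.mul_self_sqrt (Nat.cast_nonneg d), one_mul, one_div, Complex.ofReal_inv,
      Complex.ofReal_natCast]
  rw [polarDissipator_smul_smul, hscale, LinearMap.smul_apply,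
    polarDissipator_siteOp_piKronecker]

theorem lindbladian_hypercube_piKronecker {σ : ℝ} (hσ : 0 < σ) (β : ℝ)
    (u : Fin d → Matrix (Fin 2) (Fin 2) ℂ) :
    lindbladian β σ (hypercubeHamiltonian_isHermitian d) (hypercubeJump d) (piKronecker u) =
      ∑ a, piKronecker (Function.update u a (((d : ℂ)⁻¹ • qubitGenerator (theta β σ 2 2)
        (theta β σ (-2) (-2)) (theta β σ 2 (-2))) (u a))) := by
  have hperp (a : Fin d) : Pairwise fun k l =>
      (((1 / Real.sqrt d : ℝ) : ℂ) • siteOp (ladder k) a)ᴴ *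
        ((1 / Real.sqrt d : ℝ) : ℂ) • siteOp (ladder l) a = 0 := by
    intro k l hkl
    rw [Matrix.conjTranspose_smul, conjTranspose_siteOp, smul_mul_smul_comm, siteOp_mul_siteOp,
      conjTranspose_ladder_mul_ladder hkl, siteOp_zero, smul_zero]
  rw [funext hypercubeJump_eq_sum,
    lindbladian_eq_sum_polarDissipator hσ β (hypercubeHamiltonian_isHermitian d)
      (fun a k => ((isEigenoperator_ladder k).siteOp a).smul _) hperp, LinearMap.sum_apply]
  refine Finset.sum_congr rfl fun a _ => ?_
  simp only [Fin.sum_univ_two, LinearMap.add_apply, LinearMap.smul_apply,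
    polarDissipator_smul_siteOp_piKronecker, qubitGenerator, MultilinearMap.map_update_add,
    MultilinearMap.map_update_smul, ladder, Matrix.cons_val_zero, Matrix.cons_val_one,
    theta_comm β σ (-2) 2]
  module

theorem le_spectralGap_hypercube {σ : ℝ} (hσ : 0 < σ) (β : ℝ) (hd : 1 ≤ d) :
    ((theta β σ 2 2 + theta β σ (-2) (-2)) / 2 - theta β σ 2 (-2)) / d ≤
      spectralGap (lindbladian β σ (hypercubeHamiltonian_isHermitian d) (hypercubeJump d)) := by
  have hlt := two_mul_theta_lt hσ β (ν₁ := 2) (ν₂ := -2) (by norm_num)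
  have hk := theta_nonneg hσ β 2 (-2)
  have hL := lindbladian_hypercube_piKronecker (d := d) hσ β
  generalize theta β σ 2 2 = p at *
  generalize theta β σ (-2) (-2) = q at *
  generalize theta β σ 2 (-2) = k at *
  have hpq : (p : ℂ) + q ≠ 0 := by
    rw [← Complex.ofReal_add, Complex.ofReal_ne_zero]
    linarith
  have : Nonempty (Fin d) := ⟨⟨0, hd⟩⟩
  refine le_spectralGap_of_sum_site hL (qubitEigenbasis ((p - q) / (p + q)))
    (μ := fun j => (d : ℂ)⁻¹ * qubitEigenvalue p q k j) (j₀ := 0) (fun j => ?_)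
    (mul_zero _) (div_nonneg (by linarith) (Nat.cast_nonneg d)) fun j hj => ?_
  · rw [LinearMap.smul_apply, qubitEigenbasis_apply, qubitGenerator_qubitEigenop hpq, smul_smul]
  · rw [← Complex.ofReal_natCast, ← Complex.ofReal_inv, Complex.re_ofReal_mul, ← mul_neg,
      div_eq_inv_mul]
    gcongr
    exact le_neg_re_qubitEigenvalue hk hlt hj

end Hypercube

end CKG

end

theorem theorem5_general (β : ℝ) {σ : ℝ} (hσ : 0 < σ) :
    ∃ c : ℝ, 0 < c ∧ ∀ d : ℕ, 1 ≤ d →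
      c / (d : ℝ) ≤
        CKG.spectralGap
          (CKG.lindbladian β σ (CKG.hypercubeHamiltonian_isHermitian d)
            (CKG.hypercubeJump d)) := by
  have hlt := CKG.two_mul_theta_lt hσ β (ν₁ := 2) (ν₂ := -2) (by norm_num)
  exact ⟨_, by linarith, fun _ hd => CKG.le_spectralGap_hypercube hσ β hd⟩

theorem theorem5 (β : ℝ) (hβ : 0 < β) :
    ∃ σE : ℝ, 0 < σE ∧ ∃ c : ℝ, 0 < c ∧ ∀ d : ℕ, 1 ≤ d →
      c / (d : ℝ) ≤
        CKG.spectralGap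
          (CKG.lindbladian β σE (CKG.hypercubeHamiltonian_isHermitian d)
            (CKG.hypercubeJump d)) :=
  ⟨1, one_pos, theorem5_general β one_pos⟩
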